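/- A \emph{finite probability space} is a finite set (all of whose subsets are measurable) with a probability measure. A \emph{finite random source} is a collection of finite probability spaces closed under quotients: if $X$ is in the collection and there is a measure-preserving map $X \to Y$ with $Y$ a finite probability space, then $Y$ is in the collection. It is \emph{full-strength} if it contains all finite probability spaces, and it is a $\overline{\mathbb{Q}}$-random source if all measurable sets in its spaces have algebraic measure. A function $f : X_1 \times \cdots \times X_p \to Y$ of $p$ independent samples from finite probability spaces $X_1, \dots, X_p$ is \emph{robust} if its distribution does not change when the distribution of any single one of the samples is replaced by an arbitrary probability distribution (the samples remaining independent). We say that $p$ people with full-strength finite random sources \emph{can robustly simulate} a finite probability space $Y$ if there are finite probability spaces $X_1, \dots, X_p$ and a robust function $f : X_1 \times \cdots \times X_p \to Y$ whose distribution is the measure of $Y$; they can robustly simulate a finite random source if they can robustly simulate every space in it. A number $\alpha \in [0,1]$ is \emph{$p$-cooperative} if $p$ people with full-strength finite random sources can robustly simulate a coin flip with bias $\alpha$ (the space $\{H,T\}$ with masses $\alpha, 1-\alpha$). A $p$-dimensional real hypermatrix $A = (a_{k_1 \cdots k_p})$ of format $n_1 \times \cdots \times n_p$ is identified with the $p$-linear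 form $A(x^{(1)}, \dots, x^{(p)}) = \sum_{k_1, \dots, k_p} a_{k_1 \cdots k_p}\, x^{(1)}_{k_1} \cdots x^{(p)}_{k_p}$; let $J$ be the all-ones hypermatrix. $A$ has \emph{mystery-value} $\alpha$ with \emph{mystery-vectors} $\beta^{(i)} \in \mathbb{R}^{n_i}$, $1 \le i \le p$, if each $\beta^{(i)}$ has nonzero coordinate sum and, for every $1 \le j \le p$ and every $x \in \mathbb{R}^{n_j}$, $$(\alpha J - A)(\beta^{(1)}, \dots, \beta^{(j-1)}, x, \beta^{(j+1)}, \dots, \beta^{(p)}) = 0 .$$ A vector is \emph{stochastic} if its coordinates are nonnegative and sum to one. \textbf{Theorem.} Let $p \ge 3$. Then: \begin{enumerate} \item the set of $p$-cooperative numbers is exactly $\overline{\mathbb{Q}} \cap [0,1]$; \item the $p$-cooperative numbers are exactly the real numbers $\alpha$ that occur as a mystery-value of a $p$-dimensional $\{0,1\}$-hypermatrix with stochastic mystery-vectors; \item $p$ people with full-strength finite random sources can robustly simulate a finite random source if and only if it is a $\overline{\mathbb{Q}}$-random source. \end{enumerate} -/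

import Mathlib

open MeasureTheory

/-- A finite probability space: a finite set, all of whose subsets are measurable, with a
probability measure. -/
structure FinProbSpace : Type 1 where
  carrier : Type
  [fintype : Fintype carrier]
  [measurableSpace : MeasurableSpace carrier]
  [discrete : DiscreteMeasurableSpace carrier]
  μ : Measure carrier
  [isProbabilityMeasure : IsProbabilityMeasure μ]

attribute [instance] FinProbSpace.fintype FinProbSpace.measurableSpace FinProbSpace.discrete
  FinProbSpace.isProbabilityMeasure

/-- A finite random source: a collection of finite probability spaces closed under quotients,
that is, under images of measure-preserving maps. -/
structure FiniteRandomSource : Type 1 where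
  spaces : Set FinProbSpace
  quotient_mem : ∀ X ∈ spaces, ∀ (Y : FinProbSpace) (g : X.carrier → Y.carrier),
    MeasurePreserving g X.μ Y.μ → Y ∈ spaces

/-- The full-strength finite random source, which contains every finite probability space. -/
def FiniteRandomSource.full : FiniteRandomSource where
  spaces := Set.univ
  quotient_mem := fun _ _ _ _ _ => Set.mem_univ _

/-- A (finite) `S`-random source: the measures of all measurable sets of its spaces lie in `S`. -/
def FiniteRandomSource.TakesProbabilitiesIn (C : FiniteRandomSource) (S : Set ℝ) : Prop :=
  ∀ X ∈ C.spaces, ∀ s : Set X.carrier, MeasurableSet s → X.μ.real s ∈ S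

/-- The joint law of independent samples from the finite probability spaces `X i`. -/
noncomputable def jointLaw {p : ℕ} (X : Fin p → FinProbSpace) :
    Measure (∀ i, (X i).carrier) :=
  Measure.pi fun i => (X i).μ

/-- A function of `p` independent random variables is robust (that is, 1-robust) if its
distribution does not change when the distribution of any one of the variables is replaced by an
arbitrary probability distribution. -/
def IsRobust {p : ℕ} (X : Fin p → FinProbSpace) {Y : Type} [MeasurableSpace Y]
    (f : (∀ i, (X i).carrier) → Y) : Prop :=
  ∀ (j : Fin p) (ν : Measure (X j).carrier), IsProbabilityMeasure ν →
    (Measure.pi (Function.update (fun i => (X i).μ) j ν)).map f = (jointLaw X).map f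

/-- `p` people, each equipped with their own copy of the random source `C`, can robustly
simulate the space `Y`: each person `i` picks a space `X i` in `C`, and some robust function of
their independent samples has the distribution of `Y`. -/
def CanRobustlySimulateSpace (p : ℕ) (C : FiniteRandomSource) (Y : FinProbSpace) : Prop :=
  ∃ X : Fin p → FinProbSpace, (∀ i, X i ∈ C.spaces) ∧
    ∃ f : (∀ i, (X i).carrier) → Y.carrier, IsRobust X f ∧ (jointLaw X).map f = Y.μ

/-- `p` people, each equipped with the random source `C`, can robustly simulate the random
source `D`, that is, every space in `D`. -/
def CanRobustlySimulate (p : ℕ) (C D : FiniteRandomSource) : Prop :=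
  ∀ Y ∈ D.spaces, CanRobustlySimulateSpace p C Y

/-- The coin flip with bias `α`: heads (`true`) has probability `α`, tails (`false`) has
probability `1 - α`. -/
noncomputable def coin (α : ℝ) (hα : α ∈ Set.Icc (0 : ℝ) 1) : FinProbSpace where
  carrier := Bool
  μ := ENNReal.ofReal α • Measure.dirac true + ENNReal.ofReal (1 - α) • Measure.dirac false
  isProbabilityMeasure := ⟨by
    have h0 : (0 : ℝ) ≤ 1 - α := sub_nonneg.2 hα.2
    simp [← ENNReal.ofReal_add hα.1 h0]⟩

/-- The set of `p`-cooperative numbers. -/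
def cooperativeNumbers (p : ℕ) : Set ℝ :=
  {α | ∃ hα : α ∈ Set.Icc (0 : ℝ) 1,
    CanRobustlySimulateSpace p FiniteRandomSource.full (coin α hα)}

/-- A real hypermatrix of format `n 0 × ⋯ × n (p - 1)`. -/
abbrev Hypermatrix {p : ℕ} (n : Fin p → ℕ) : Type := (∀ i, Fin (n i)) → ℝ

/-- The value at `(x 0, …, x (p - 1))` of the `p`-linear form with hypermatrix `A`. -/
def Hypermatrix.form {p : ℕ} {n : Fin p → ℕ} (A : Hypermatrix n)
    (x : ∀ i, Fin (n i) → ℝ) : ℝ :=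
  ∑ k : (∀ i, Fin (n i)), A k * ∏ i, x i (k i)

/-- The all-ones hypermatrix. -/
def Hypermatrix.allOnes {p : ℕ} (n : Fin p → ℕ) : Hypermatrix n := fun _ => 1

/-- `A` has mystery-value `α` with corresponding mystery-vectors `β i`: the form `α J - A`
vanishes whenever all but one of its arguments are the `β i`, and no `β i` has coordinate sum
zero. -/
def Hypermatrix.HasMysteryValue {p : ℕ} {n : Fin p → ℕ} (A : Hypermatrix n) (α : ℝ)
    (β : ∀ i, Fin (n i) → ℝ) : Prop :=
  (∀ (j : Fin p) (x : Fin (n j) → ℝ),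
    Hypermatrix.form (α • Hypermatrix.allOnes n - A) (Function.update β j x) = 0) ∧
  ∀ i, ∑ k, β i k ≠ 0

/-! Robustness means that, for each outcome, the multilinear form of the `{0,1}`-hypermatrix of that
event is stationary: with all arguments but one fixed, it equals `α` times the coordinate sum of the
free argument.

Only algebraic masses occur. If `α` were transcendental, some derivation `D` of `ℝ` over `ℚ` would
have `D α = 1`. Differentiating the form argument by argument, stationarity turns the `j`-th term
into `α * D (∑ t, w j t) = α * D 1 = 0`, a contradiction (`HasStationaryValue.isAlgebraic`).

Conversely, let `c` be positive algebraic masses with sum one. Multiplication by the `c y` on the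
number field they generate gives rational matrices `M y` with common eigenvectors `u` and `v`, where
`v ⬝ u = 1`. The function `w + v (M - w) u` is affine in each of `w`, `u`, `v` and equals `c` as
soon as two of them have their critical values. Averaging each argument over rational points turns
this into a three-dimensional array of rational probability distributions with stationary value `c`
(`exists_rational_distributions`); positivity of `c` makes the entries nonnegative once the points
for `w` and `u` are close enough.

Rational distributions are then made deterministic by a sum of two independent uniform elements of
`ZMod N`, which stays uniform if one summand is replaced (`exists_hasStationaryValue_of_pos`).
Further people are ignored. -/

/-! ### Derivations and transcendental elements. -/

open TensorProduct in
/-- Derivations extend uniquely along formally étale algebras; this is the existence part. -/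
theorem Derivation.exists_extension_of_formallyEtale {R S T : Type} [CommRing R] [CommRing S]
    [CommRing T] [Algebra R S] [Algebra R T] [Algebra S T] [IsScalarTower R S T]
    [Algebra.FormallyEtale S T] (d : Derivation R S T) :
    ∃ D : Derivation R T T, ∀ s, D (algebraMap S T s) = d s := by
  -- Étaleness gives `T ⊗[S] Ω[S⁄R] ≃ Ω[T⁄R]`, so the linear map representing `d` induces one on
  -- `Ω[T⁄R]`.
  let e := KaehlerDifferential.tensorKaehlerEquivOfFormallyEtale R S T
  let f : T ⊗[S] Ω[S⁄R] →ₗ[T] T := d.liftKaehlerDifferential.liftBaseChange T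
  refine ⟨(f ∘ₗ e.symm.toLinearMap).compDer (KaehlerDifferential.D R T), fun s => ?_⟩
  have h := KaehlerDifferential.tensorKaehlerEquivOfFormallyEtale_symm_D_algebraMap R S T s
  simp [e, f, h]

open scoped IntermediateField.algebraAdjoinAdjoin in
/-- In characteristic zero, some derivation does not vanish at a given transcendental element. -/
theorem Transcendental.exists_derivation {F E : Type} [Field F] [Field E] [Algebra F E]
    [CharZero F] {a : E} (ha : Transcendental F a) :
    ∃ D : Derivation F E E, D a = 1 := by
  have hind : AlgebraicIndepOn F id ({a} : Set E) :=
    algebraicIndependent_unique_type_iff.2 ha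
  -- With `a` in a transcendence basis, the derivation is `∂/∂a` on the polynomial ring `S`. It
  -- extends to `E` because localization to `L` and the algebraic extension `E / L`, separable in
  -- characteristic zero, are both formally étale.
  obtain ⟨s, has, hs⟩ := exists_isTranscendenceBasis_superset hind
  have hv := hs.1
  let S := Algebra.adjoin F (Set.range ((↑) : s → E))
  let L := IntermediateField.adjoin F (Set.range ((↑) : s → E))
  let e : MvPolynomial s F ≃ₐ[F] S := hv.aevalEquiv
  have : Algebra.FormallyEtale S L := .of_isLocalization (nonZeroDivisors _)
  have : Algebra.IsAlgebraic L E := hs.isAlgebraic_field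
  have : Algebra.FormallyEtale L E := .of_isSeparable L E
  have : Algebra.FormallyEtale S E := .comp S L E
  let a' : s := ⟨a, has rfl⟩
  let d : Derivation F S E := Derivation.mk'
    (S.val.toLinearMap ∘ₗ e.toLinearMap ∘ₗ (MvPolynomial.pderiv a').toLinearMap ∘ₗ
      e.symm.toLinearMap) fun x y => by
        simp [Algebra.smul_def]
  obtain ⟨D, hD⟩ := d.exists_extension_of_formallyEtale
  refine ⟨D, ?_⟩
  have h := hD (e (MvPolynomial.X a'))
  have h1 : algebraMap S E (e (MvPolynomial.X a')) = a := by
    simp [e, S, a']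
  rw [h1] at h
  rw [h]
  simp [d]

/-! ### Multilinear forms and stationary values. -/

section MultilinearForm

variable {ι : Type} [Fintype ι] [DecidableEq ι] {X : ι → Type} [∀ i, Fintype (X i)]

/-- The multilinear form with coefficients `A`. -/
def multiForm (A : (∀ i, X i) → ℝ) (w : ∀ i, X i → ℝ) : ℝ :=
  ∑ k : ∀ i, X i, A k * ∏ i, w i (k i)

theorem multiForm_update (A : (∀ i, X i) → ℝ) (w : ∀ i, X i → ℝ) (j : ι) (x : X j → ℝ) :
    multiForm A (Function.update w j x) =
      ∑ k : ∀ i, X i, A k * (x (k j) * ∏ i ∈ Finset.univ.erase j, w i (k i)) := by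
  refine Finset.sum_congr rfl fun k _ => ?_
  rw [← Finset.mul_prod_erase _ _ (Finset.mem_univ j), Function.update_self]
  congr 2
  refine Finset.prod_congr rfl fun i hi => ?_
  rw [Function.update_of_ne (Finset.ne_of_mem_erase hi)]

theorem multiForm_update_eq_sum [∀ i, DecidableEq (X i)] (A : (∀ i, X i) → ℝ)
    (w : ∀ i, X i → ℝ) (j : ι) (x : X j → ℝ) :
    multiForm A (Function.update w j x) =
      ∑ t, x t * multiForm A (Function.update w j (Pi.single t 1)) := by
  simp only [multiForm_update, Finset.mul_sum]
  rw [Finset.sum_comm]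
  refine Finset.sum_congr rfl fun k _ => ?_
  rw [Finset.sum_eq_single (k j)]
  · simp [mul_left_comm]
  · intro t _ ht
    simp [ht.symm]
  · simp

/-- The form of `A` has value `α` at `w`, and stays equal to `α` when a single `w j` is replaced
by any vector with coordinate sum one. -/
def HasStationaryValue (A : (∀ i, X i) → ℝ) (w : ∀ i, X i → ℝ) (α : ℝ) : Prop :=
  ∀ (j : ι) (x : X j → ℝ), multiForm A (Function.update w j x) = α * ∑ t, x t

/-- By linearity in the free argument, it is enough to test deterministic replacements. -/
theorem hasStationaryValue_of_single [∀ i, DecidableEq (X i)] {A : (∀ i, X i) → ℝ}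
    {w : ∀ i, X i → ℝ} {α : ℝ}
    (h : ∀ (j : ι) (t : X j), multiForm A (Function.update w j (Pi.single t 1)) = α) :
    HasStationaryValue A w α := by
  intro j x
  rw [multiForm_update_eq_sum, Finset.mul_sum]
  exact Finset.sum_congr rfl fun t _ => by rw [h, mul_comm]

theorem HasStationaryValue.multiForm_eq {A : (∀ i, X i) → ℝ} {w : ∀ i, X i → ℝ} {α : ℝ} [Nonempty ι]
    (h : HasStationaryValue A w α) (hw : ∀ i, ∑ t, w i t = 1) : multiForm A w = α := by
  obtain ⟨j⟩ := ‹Nonempty ι›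
  have := h j (w j)
  rwa [Function.update_eq_self, hw, mul_one] at this

/-- A derivation over `ℚ` differentiates a form with rational coefficients argument by
argument. -/
theorem Derivation.map_multiForm (D : Derivation ℚ ℝ ℝ) {A : (∀ i, X i) → ℝ}
    (hA : ∀ k, D (A k) = 0) (w : ∀ i, X i → ℝ) :
    D (multiForm A w) = ∑ j, multiForm A (Function.update w j fun t => D (w j t)) := by
  have hprod (s : Finset ι) (g : ι → ℝ) :
      D (∏ i ∈ s, g i) = ∑ j ∈ s, D (g j) * ∏ i ∈ s.erase j, g i := by
    induction s using Finset.induction_on with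
    | empty => simp
    | insert a s ha ih =>
      rw [Finset.prod_insert ha, Derivation.leibniz, ih, Finset.sum_insert ha,
        Finset.erase_insert ha, add_comm, smul_eq_mul, smul_eq_mul, mul_comm, Finset.mul_sum]
      congr 1
      refine Finset.sum_congr rfl fun j hj => ?_
      have hja : a ≠ j := fun h => ha (h ▸ hj)
      rw [Finset.erase_insert_of_ne hja, Finset.prod_insert (by simp [ha])]
      ring
  simp only [multiForm_update]
  rw [Finset.sum_comm, multiForm, map_sum]
  refine Finset.sum_congr rfl fun k _ => ?_
  rw [Derivation.leibniz, hA, smul_zero, add_zero, hprod, smul_eq_mul, Finset.mul_sum]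

/-- A stationary value of a form with `{0, 1}`-coefficients is algebraic. -/
theorem HasStationaryValue.isAlgebraic [Nonempty ι] {A : (∀ i, X i) → ℝ} {w : ∀ i, X i → ℝ} {α : ℝ}
    (h : HasStationaryValue A w α) (hA : ∀ k, A k = 0 ∨ A k = 1) (hw : ∀ i, ∑ t, w i t = 1) :
    IsAlgebraic ℚ α := by
  by_contra hα
  obtain ⟨D, hD⟩ := Transcendental.exists_derivation hα
  have hDA k : D (A k) = 0 := by rcases hA k with h | h <;> simp [h]
  have key := D.map_multiForm hDA w
  rw [h.multiForm_eq hw, hD] at key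
  -- Stationarity holds for all real vectors, in particular for the derivative of `w j`, whose
  -- coordinate sum is `D 1 = 0`.
  refine one_ne_zero (key.trans (Finset.sum_eq_zero fun j _ => ?_))
  rw [h, ← map_sum, hw, Derivation.map_one_eq_zero, mul_zero]

end MultilinearForm

/-! ### Robust functions as stationary values. -/

section Robustness

/-- The `{0, 1}`-coefficients of the event `f = y`. -/
noncomputable def eventCoeff {Ω Y : Type} (f : Ω → Y) (y : Y) : Ω → ℝ :=
  (f ⁻¹' {y}).indicator 1

theorem eventCoeff_eq_zero_or_one {Ω Y : Type} (f : Ω → Y) (y : Y) (k : Ω) :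
    eventCoeff f y k = 0 ∨ eventCoeff f y k = 1 :=
  (Set.indicator_eq_zero_or_self _ _ k).imp id id

theorem eventCoeff_apply {Ω Y : Type} [DecidableEq Y] (f : Ω → Y) (y : Y) (k : Ω) :
    eventCoeff f y k = if f k = y then 1 else 0 := by
  by_cases h : f k = y <;> simp [eventCoeff, h]

theorem map_pi_real_singleton {ι : Type} [Fintype ι] [DecidableEq ι] {X : ι → Type}
    [∀ i, Fintype (X i)] [∀ i, MeasurableSpace (X i)] [∀ i, DiscreteMeasurableSpace (X i)]
    (μ : ∀ i, Measure (X i)) [∀ i, IsProbabilityMeasure (μ i)] {Y : Type} [MeasurableSpace Y]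
    [DiscreteMeasurableSpace Y] (f : (∀ i, X i) → Y) (y : Y) :
    ((Measure.pi μ).map f).real {y} =
      multiForm (eventCoeff f y) fun i t => (μ i).real {t} := by
  classical
  rw [map_measureReal_apply (measurable_of_finite f) (measurableSet_singleton y)]
  have h : f ⁻¹' {y} = ((Finset.univ.filter fun k => f k = y : Finset (∀ i, X i)) : Set _) := by
    ext; simp
  rw [h, ← sum_measureReal_singleton, Finset.sum_filter, multiForm]
  refine Finset.sum_congr rfl fun k _ => ?_
  simp [eventCoeff_apply, Measure.real, ENNReal.toReal_prod]

theorem map_pi_update_real_singleton {ι : Type} [Fintype ι] [DecidableEq ι] {X : ι → Type}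
    [∀ i, Fintype (X i)] [∀ i, MeasurableSpace (X i)] [∀ i, DiscreteMeasurableSpace (X i)]
    (μ : ∀ i, Measure (X i)) [∀ i, IsProbabilityMeasure (μ i)] {Y : Type} [MeasurableSpace Y]
    [DiscreteMeasurableSpace Y] (f : (∀ i, X i) → Y) (y : Y) (j : ι) (ν : Measure (X j))
    [IsProbabilityMeasure ν] :
    ((Measure.pi (Function.update μ j ν)).map f).real {y} =
      multiForm (eventCoeff f y)
        (Function.update (fun i t => (μ i).real {t}) j fun t => ν.real {t}) := by
  have (i : ι) : IsProbabilityMeasure (Function.update μ j ν i) := by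
    rcases eq_or_ne i j with rfl | h
    · simpa
    · simpa [h] using inferInstanceAs (IsProbabilityMeasure (μ i))
  rw [map_pi_real_singleton]
  congr 1
  funext i
  rcases eq_or_ne i j with rfl | h <;> simp [*]

theorem sum_real_singleton_eq_one {T : Type} [Fintype T] [MeasurableSpace T]
    [DiscreteMeasurableSpace T] (μ : Measure T) [IsProbabilityMeasure μ] :
    ∑ t, μ.real {t} = 1 := by
  simp

/-- A function is robust with the law of `Y` if and only if the masses of `Y` are stationary
values of its events. -/
theorem isRobust_and_map_eq_iff {p : ℕ} [NeZero p] (X : Fin p → FinProbSpace) (Y : FinProbSpace)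
    (f : (∀ i, (X i).carrier) → Y.carrier) :
    (IsRobust X f ∧ (jointLaw X).map f = Y.μ) ↔
      ∀ y, HasStationaryValue (eventCoeff f y) (fun i t => (X i).μ.real {t}) (Y.μ.real {y}) := by
  classical
  constructor
  · rintro ⟨hf, hY⟩ y
    refine hasStationaryValue_of_single fun j t => ?_
    have h := map_pi_update_real_singleton (fun i => (X i).μ) f y j (Measure.dirac t)
    rw [hf j _ inferInstance, hY] at h
    rw [h]
    congr 2
    funext s
    simp [Measure.real, Pi.single_apply, Set.indicator_apply, eq_comm, apply_ite]
  · intro h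
    have hY : (jointLaw X).map f = Y.μ := by
      have : IsProbabilityMeasure ((jointLaw X).map f) :=
        Measure.isProbabilityMeasure_map (μ := Measure.pi fun i => (X i).μ)
          (measurable_of_finite f).aemeasurable
      refine ext_iff_measureReal_singleton.2 fun y => ?_
      rw [← (h y).multiForm_eq fun i => sum_real_singleton_eq_one _]
      exact map_pi_real_singleton (fun i => (X i).μ) f y
    refine ⟨fun j ν hν => ?_, hY⟩
    have (i : Fin p) : IsProbabilityMeasure (Function.update (fun i => (X i).μ) j ν i) := by
      rcases eq_or_ne i j with rfl | h
      · simpa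
      · simpa [h] using inferInstanceAs (IsProbabilityMeasure (X i).μ)
    have : IsProbabilityMeasure
        ((Measure.pi (Function.update (fun i => (X i).μ) j ν)).map f) :=
      Measure.isProbabilityMeasure_map (measurable_of_finite f).aemeasurable
    rw [hY]
    refine ext_iff_measureReal_singleton.2 fun y => ?_
    rw [map_pi_update_real_singleton, h y, sum_real_singleton_eq_one, mul_one]

/-- The finite probability space with given point masses. -/
noncomputable def FinProbSpace.ofWeights {T : Type} [Fintype T] (w : T → ℝ)
    (hw : w ∈ stdSimplex ℝ T) : FinProbSpace :=
  let _ : MeasurableSpace T := ⊤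
  { carrier := T
    μ := ∑ t, ENNReal.ofReal (w t) • Measure.dirac t
    isProbabilityMeasure := ⟨by
      simp [← ENNReal.ofReal_sum_of_nonneg fun t _ => hw.1 t, hw.2]⟩ }

theorem FinProbSpace.ofWeights_real_singleton {T : Type} [Fintype T] (w : T → ℝ)
    (hw : w ∈ stdSimplex ℝ T) (t : T) :
    (FinProbSpace.ofWeights w hw).μ.real {t} = w t := by
  classical
  let _ : MeasurableSpace T := ⊤
  change ((∑ s, ENNReal.ofReal (w s) • Measure.dirac s : Measure T) {t}).toReal = w t
  simp [Measure.finsetSum_apply, Set.indicator_apply, hw.1 t]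

end Robustness

/-! ### Rational data attached to algebraic masses. -/

/-- Multiplication by finitely many real algebraic numbers is given by commuting rational matrices
with a common right eigenvector `u` and a common left eigenvector `v`, normalized by
`v ⬝ u = 1`. -/
theorem exists_rational_matrices_with_eigenvectors {Y : Type} [Fintype Y] (c : Y → ℝ)
    (hc : ∀ y, IsAlgebraic ℚ (c y)) (hsum : ∑ y, c y = 1) :
    ∃ (ι : Type) (_ : Fintype ι) (M : Y → ι → ι → ℚ) (u v : ι → ℝ),
      (∀ y i, ∑ j, (M y i j : ℝ) * u j = c y * u i) ∧
      (∀ y j, ∑ i, v i * (M y i j : ℝ) = c y * v j) ∧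
      ∑ i, v i * u i = 1 ∧
      ∀ x z : ι → ℚ, ∑ y, ∑ i, x i * ∑ j, M y i j * z j = ∑ i, x i * z i := by
  classical
  let K := IntermediateField.adjoin ℚ (Set.range c)
  have : FiniteDimensional ℚ K :=
    IntermediateField.finiteDimensional_adjoin fun x hx => by
      obtain ⟨y, rfl⟩ := hx
      exact (hc y).isIntegral
  let κ : Y → K := fun y => ⟨c y, IntermediateField.subset_adjoin _ _ ⟨y, rfl⟩⟩
  have hκ : ∑ y, κ y = 1 := Subtype.ext (by simpa [κ] using hsum)
  let b := Module.finBasis ℚ K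
  let b' := b.traceDual
  have hcoeff (x : K) (i) : b.repr x i = Algebra.trace ℚ K (x * b' i) := by
    conv_lhs => rw [← b.traceDual_traceDual]
    rw [Module.Basis.traceDual_repr_apply, Algebra.traceForm_apply]
  have hrepr (x : K) : x = ∑ i, Algebra.trace ℚ K (x * b' i) • b i := by
    simp only [← hcoeff, b.sum_repr]
  have hrepr' (x : K) : x = ∑ i, Algebra.trace ℚ K (x * b i) • b' i := by
    conv_lhs => rw [← b'.sum_repr x]
    refine Finset.sum_congr rfl fun i _ => ?_
    rw [Module.Basis.traceDual_repr_apply, Algebra.traceForm_apply]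
  -- Paired with any `x` under the trace form, the left side gives the sum of the diagonal entries
  -- of multiplication by `x`, which is the trace of `x`.
  have hone : ∑ i, b i * b' i = 1 := by
    refine sub_eq_zero.1 ((traceForm_nondegenerate ℚ K).1 _ fun x => ?_)
    rw [Algebra.traceForm_apply, sub_mul, one_mul, map_sub, sub_eq_zero,
      Algebra.trace_eq_matrix_trace b x, Finset.sum_mul, map_sum, Matrix.trace]
    refine Finset.sum_congr rfl fun i _ => ?_
    rw [Matrix.diag_apply, Algebra.leftMulMatrix_eq_repr_mul, hcoeff, mul_comm, mul_assoc]
  have hcast (q : ℚ) (x : K) : ((q • x : K) : ℝ) = (q : ℝ) * x := by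
    rw [Algebra.smul_def]; rfl
  -- The entries are traces against a basis and its trace-dual, so the expansions `hrepr'` and
  -- `hrepr` are exactly the two eigenvector equations, with `b'` on the right and `b` on the left.
  refine ⟨_, inferInstance, fun y i j => Algebra.trace ℚ K (κ y * b' i * b j),
    fun i => b' i, fun i => b i, fun y i => ?_, fun y j => ?_, ?_, fun x z => ?_⟩
  · have h := congrArg (Subtype.val : K → ℝ) (hrepr' (κ y * b' i))
    simpa [hcast] using h.symm
  · have h := congrArg (Subtype.val : K → ℝ) (hrepr (κ y * b j))
    simp only [AddSubmonoidClass.coe_finsetSum, hcast] at h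
    refine Eq.trans (Finset.sum_congr rfl fun i _ => ?_) h.symm
    rw [mul_comm, mul_right_comm]
  · simpa using congrArg (Subtype.val : K → ℝ) hone
  · simp only [Finset.mul_sum]
    rw [Finset.sum_comm]
    refine Finset.sum_congr rfl fun i _ => ?_
    rw [Finset.sum_comm]
    simp only [← Finset.mul_sum, ← Finset.sum_mul, ← map_sum, mul_assoc, hκ, one_mul]
    simp [b']

/-- Every real vector is a finite convex combination of rational vectors arbitrarily close to
it. -/
theorem exists_rational_convex_combination {ι : Type} [Fintype ι] (x : ι → ℝ) {ε : ℝ}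
    (hε : 0 < ε) :
    ∃ (T : Type) (_ : Fintype T) (q : T → ι → ℚ) (μ : T → ℝ), μ ∈ stdSimplex ℝ T ∧
      (∀ t i, |(q t i : ℝ) - x i| < ε) ∧ ∀ i, ∑ t, μ t * (q t i : ℝ) = x i := by
  classical
  obtain ⟨η, hη0, hηε⟩ : ∃ η : ℚ, (0 : ℝ) < η ∧ (η : ℝ) < ε / 2 := exists_rat_btwn (by positivity)
  -- This makes the weights `(x i - r i) / η` sum to at most one.
  let δ : ℝ := η / (Fintype.card ι + 1)
  have hδ : 0 < δ := by positivity
  have hδη : δ ≤ η := div_le_self hη0.le (by simp)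
  have (i : ι) : ∃ r : ℚ, x i - δ < r ∧ (r : ℝ) < x i := exists_rat_btwn (by linarith)
  choose r hr1 hr2 using this
  -- The points are the vertices of a small simplex: `r` itself, carrying the leftover weight, and
  -- `r` shifted by `η` in one coordinate.
  refine ⟨Option ι, inferInstance, fun t i => r i + if t = some i then η else 0,
    fun t => t.elim (1 - ∑ i, (x i - r i) / η) fun i => (x i - r i) / η, ⟨?_, ?_⟩, ?_, ?_⟩
  · rintro (_ | i)
    · have h : ∑ i, (x i - r i) / (η : ℝ) ≤ ∑ _i : ι, δ / η :=
        Finset.sum_le_sum fun i _ => by gcongr; linarith [hr1 i]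
      have h2 : ∑ _i : ι, δ / (η : ℝ) ≤ 1 := by
        simp only [Finset.sum_const, Finset.card_univ, nsmul_eq_mul, δ]
        rw [div_div, mul_comm ((Fintype.card ι : ℝ) + 1), ← div_div, div_self hη0.ne',
          mul_one_div, div_le_one (by positivity)]
        linarith
      simpa using h.trans h2
    · exact div_nonneg (by linarith [hr2 i]) hη0.le
  · simp [Fintype.sum_option]
  · intro t i
    rw [abs_lt]
    push_cast
    split_ifs <;> constructor <;> push_cast <;> linarith [hr1 i, hr2 i]
  · intro i
    have h (t : Option ι) : ((r i + if t = some i then η else 0 : ℚ) : ℝ) =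
        r i + if t = some i then (η : ℝ) else 0 := by split_ifs <;> simp
    simp only [h, mul_add, Finset.sum_add_distrib, ← Finset.sum_mul, mul_ite, mul_zero,
      Finset.sum_ite_eq', Finset.mem_univ, if_true]
    simp only [Fintype.sum_option, Option.elim]
    field_simp
    ring

/-! ### The critical form and its affinity in each argument. -/

section CriticalForm

variable {K Y ι : Type} [Field K] [Fintype Y] [Fintype ι]

/-- The affine projection onto the vectors with coordinate sum one. -/
def normalizeSum (w : Y → K) (y : Y) : K :=
  w y + (1 - ∑ z, w z) / Fintype.card Y

theorem sum_normalizeSum [CharZero K] [Nonempty Y] (w : Y → K) : ∑ y, normalizeSum w y = 1 := by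
  have : (Fintype.card Y : K) ≠ 0 := by simp
  simp only [normalizeSum, Finset.sum_add_distrib, Finset.sum_const, Finset.card_univ,
    nsmul_eq_mul]
  field_simp
  ring

theorem normalizeSum_of_sum_eq_one {w : Y → K} (hw : ∑ y, w y = 1) : normalizeSum w = w := by
  funext y; simp [normalizeSum, hw]

/-- The function `w + v (M - w) u`, affine in each of the vectors `w`, `u` and `v`. It is critical
at simultaneous eigenvectors `u`, `v` of `M` for the eigenvalue `w`, if `v ⬝ u = 1`. -/
def criticalForm (M : Y → ι → ι → K) (w : Y → K) (u v : ι → K) (y : Y) : K :=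
  normalizeSum w y + ∑ i, v i * (∑ j, M y i j * u j - normalizeSum w y * u i)

theorem criticalForm_eq (M : Y → ι → ι → K) (w : Y → K) (u v : ι → K) (y : Y) :
    criticalForm M w u v y = normalizeSum w y + ∑ i, v i * ∑ j, M y i j * u j -
      normalizeSum w y * ∑ i, v i * u i := by
  simp only [criticalForm, mul_sub, Finset.sum_sub_distrib, Finset.mul_sum]
  rw [← add_sub_assoc]
  congr 1
  exact Finset.sum_congr rfl fun i _ => by ring

theorem criticalForm_eq' (M : Y → ι → ι → K) (w : Y → K) (u v : ι → K) (y : Y) :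
    criticalForm M w u v y = normalizeSum w y + ∑ j, (∑ i, v i * M y i j) * u j -
      normalizeSum w y * ∑ i, v i * u i := by
  rw [criticalForm_eq]
  congr 2
  simp only [Finset.mul_sum, Finset.sum_mul, mul_assoc]
  exact Finset.sum_comm

/-- The hypothesis says that the `M y` sum to the identity, so the correction terms cancel.
Normalizing `w` is what keeps the sum equal to one for arbitrary `w`. -/
theorem sum_criticalForm [CharZero K] [Nonempty Y] (M : Y → ι → ι → K)
    (hM : ∀ x z : ι → K, ∑ y, ∑ i, x i * ∑ j, M y i j * z j = ∑ i, x i * z i)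
    (w : Y → K) (u v : ι → K) : ∑ y, criticalForm M w u v y = 1 := by
  simp only [criticalForm_eq, Finset.sum_sub_distrib, Finset.sum_add_distrib, hM,
    ← Finset.sum_mul, sum_normalizeSum]
  ring

theorem criticalForm_ratCast (M : Y → ι → ι → ℚ) (w : Y → ℚ) (u v : ι → ℚ) (y : Y) :
    ((criticalForm M w u v y : ℚ) : ℝ) = criticalForm (fun y i j => (M y i j : ℝ))
      (fun y => (w y : ℝ)) (fun i => (u i : ℝ)) (fun i => (v i : ℝ)) y := by
  simp [criticalForm, normalizeSum]

variable {T : Type} [Fintype T] {μ : T → K}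

theorem sum_mul_normalizeSum (hμ : ∑ t, μ t = 1) (w : T → Y → K) (y : Y) :
    ∑ t, μ t * normalizeSum (w t) y = normalizeSum (fun z => ∑ t, μ t * w t z) y := by
  simp only [normalizeSum, mul_add, Finset.sum_add_distrib, mul_div_assoc', mul_sub,
    ← Finset.sum_div, Finset.sum_sub_distrib, mul_one, hμ, Finset.mul_sum]
  rw [Finset.sum_comm]

/-- Affinity lets an average over random rational points be replaced by the value at their mean,
here and in the two analogues for `u` and `v`. -/
theorem sum_mul_criticalForm_first (hμ : ∑ t, μ t = 1) (M : Y → ι → ι → K) (w : T → Y → K)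
    (u v : ι → K) (y : Y) :
    ∑ t, μ t * criticalForm M (w t) u v y =
      criticalForm M (fun z => ∑ t, μ t * w t z) u v y := by
  simp only [criticalForm_eq, ← sum_mul_normalizeSum hμ, mul_sub, mul_add,
    Finset.sum_sub_distrib, Finset.sum_add_distrib]
  rw [← Finset.sum_mul, hμ, one_mul]
  simp only [← mul_assoc, ← Finset.sum_mul]

theorem sum_mul_criticalForm_second (hμ : ∑ t, μ t = 1) (M : Y → ι → ι → K) (w : Y → K)
    (u : T → ι → K) (v : ι → K) (y : Y) :
    ∑ t, μ t * criticalForm M w (u t) v y =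
      criticalForm M w (fun i => ∑ t, μ t * u t i) v y := by
  have h (x : ι → K) : ∑ t, μ t * ∑ i, x i * u t i = ∑ i, x i * ∑ t, μ t * u t i := by
    simp only [Finset.mul_sum]
    rw [Finset.sum_comm]
    exact Finset.sum_congr rfl fun _ _ => Finset.sum_congr rfl fun _ _ => by ring
  simp only [criticalForm_eq', mul_sub, mul_add, Finset.sum_sub_distrib, Finset.sum_add_distrib,
    mul_left_comm (μ _) (normalizeSum w y), ← Finset.mul_sum, h]
  rw [← Finset.sum_mul, hμ, one_mul]

theorem sum_mul_criticalForm_third (hμ : ∑ t, μ t = 1) (M : Y → ι → ι → K) (w : Y → K)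
    (u : ι → K) (v : T → ι → K) (y : Y) :
    ∑ t, μ t * criticalForm M w u (v t) y =
      criticalForm M w u (fun i => ∑ t, μ t * v t i) y := by
  have h (x : ι → K) : ∑ t, μ t * ∑ i, v t i * x i = ∑ i, (∑ t, μ t * v t i) * x i := by
    simp only [Finset.mul_sum, Finset.sum_mul]
    rw [Finset.sum_comm]
    exact Finset.sum_congr rfl fun _ _ => Finset.sum_congr rfl fun _ _ => by ring
  simp only [criticalForm_eq, mul_sub, mul_add, Finset.sum_sub_distrib, Finset.sum_add_distrib,
    mul_left_comm (μ _) (normalizeSum w y), ← Finset.mul_sum, h]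
  rw [← Finset.sum_mul, hμ, one_mul]

end CriticalForm

/-- Positive algebraic masses are the stationary values of a three-dimensional hypermatrix whose
entries are rational probability distributions. -/
theorem exists_rational_distributions {Y : Type} [Fintype Y] (c : Y → ℝ)
    (hc : ∀ y, IsAlgebraic ℚ (c y)) (hpos : ∀ y, 0 < c y) (hsum : ∑ y, c y = 1) :
    ∃ (W U V : Type) (_ : Fintype W) (_ : Fintype U) (_ : Fintype V)
      (μ : W → ℝ) (ν : U → ℝ) (ρ : V → ℝ) (G : W → U → V → Y → ℚ),
      μ ∈ stdSimplex ℝ W ∧ ν ∈ stdSimplex ℝ U ∧ ρ ∈ stdSimplex ℝ V ∧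
      (∀ a b d y, 0 ≤ G a b d y) ∧ (∀ a b d, ∑ y, G a b d y = 1) ∧
      (∀ a y, ∑ b, ν b * ∑ d, ρ d * (G a b d y : ℝ) = c y) ∧
      (∀ b y, ∑ a, μ a * ∑ d, ρ d * (G a b d y : ℝ) = c y) ∧
      (∀ d y, ∑ a, μ a * ∑ b, ν b * (G a b d y : ℝ) = c y) := by
  obtain ⟨ι, _, M, u, v, hu, hv, hvu, hM⟩ := exists_rational_matrices_with_eigenvectors c hc hsum
  have : Nonempty Y := by
    by_contra h
    rw [not_nonempty_iff] at h
    simp at hsum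
  let F := criticalForm (fun y i j => (M y i j : ℝ))
  have hn := normalizeSum_of_sum_eq_one hsum
  have hF1 (w y) : F w u v y = c y := by
    simp [F, criticalForm_eq, hu, mul_left_comm _ (c y), ← Finset.mul_sum, hvu]
  have hF2 (z y) : F c z v y = c y := by
    simp [F, criticalForm_eq', hv, hn, mul_assoc, ← Finset.mul_sum]
  have hF3 (z y) : F c u z y = c y := by
    simp [F, criticalForm_eq, hu, hn, mul_left_comm _ (c y), ← Finset.mul_sum]
  -- The points for `v` need not be near `v`: at `(c, u)` the value is `c` for every third argument.
  -- They are fixed first, so that positivity for these finitely many points is an open condition on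
  -- the other two arguments.
  obtain ⟨V, _, qV, ρ, hρ, -, hqV⟩ := exists_rational_convex_combination v one_pos
  have hev : ∀ᶠ x in nhds (c, u), ∀ d y, 0 < F x.1 x.2 (fun i => (qV d i : ℝ)) y := by
    simp only [Filter.eventually_all]
    intro d y
    have hcont : Continuous fun x : (Y → ℝ) × (ι → ℝ) =>
        F x.1 x.2 (fun i => (qV d i : ℝ)) y := by
      simp only [F, criticalForm, normalizeSum]
      fun_prop
    exact hcont.continuousAt.eventually (lt_mem_nhds (by simpa only [hF3] using hpos y))
  obtain ⟨ε, hε, hball⟩ := Metric.eventually_nhds_iff.1 hev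
  obtain ⟨W, _, qW, μ, hμ, hqWε, hqW⟩ := exists_rational_convex_combination c hε
  obtain ⟨U, _, qU, ν, hν, hqUε, hqU⟩ := exists_rational_convex_combination u hε
  refine ⟨W, U, V, inferInstance, inferInstance, inferInstance, μ, ν, ρ,
    fun a b d => criticalForm M (qW a) (qU b) (qV d), hμ, hν, hρ, fun a b d y => ?_,
    fun a b d => sum_criticalForm M hM _ _ _, fun a y => ?_, fun b y => ?_, fun d y => ?_⟩
  · have h := hball (y := (fun y => (qW a y : ℝ), fun i => (qU b i : ℝ))) ?_ d y
    · rw [← Rat.cast_nonneg (K := ℝ), criticalForm_ratCast]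
      exact h.le
    · rw [Prod.dist_eq, max_lt_iff, dist_pi_lt_iff hε, dist_pi_lt_iff hε]
      exact ⟨hqWε a, hqUε b⟩
  · simp only [criticalForm_ratCast]
    simp only [sum_mul_criticalForm_third hρ.2, sum_mul_criticalForm_second hν.2, hqV, hqU]
    exact hF1 _ y
  · simp only [criticalForm_ratCast]
    simp only [sum_mul_criticalForm_third hρ.2, sum_mul_criticalForm_first hμ.2, hqV, hqW]
    exact hF2 _ y
  · simp only [criticalForm_ratCast]
    simp only [sum_mul_criticalForm_second hν.2, sum_mul_criticalForm_first hμ.2, hqU, hqW]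
    exact hF3 _ y

/-! ### From rational distributions to deterministic functions. -/

/-- A form depending on the first three arguments only. -/
theorem multiForm_three {q : ℕ} {T : Type} [Fintype T] (h : T → T → T → ℝ)
    (w : Fin (q + 3) → T → ℝ) (hw : ∀ i : Fin q, ∑ t, w i.succ.succ.succ t = 1) :
    multiForm (fun k : Fin (q + 3) → T => h (k 0) (k 1) (k 2)) w =
      ∑ a, w 0 a * ∑ b, w 1 b * ∑ d, w 2 d * h a b d := by
  have step {n : ℕ} (φ : (Fin (n + 1) → T) → ℝ) :
      ∑ k, φ k = ∑ a, ∑ k, φ (Fin.cons a k) := by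
    rw [← (Fin.consEquiv fun _ : Fin (n + 1) => T).sum_comp, Fintype.sum_prod_type]
    rfl
  have hrest : ∑ k : Fin q → T, ∏ i : Fin q, w i.succ.succ.succ (k i) = 1 := by
    rw [← Fintype.prod_sum fun (i : Fin q) t => w i.succ.succ.succ t]
    simp [hw]
  rw [multiForm, step]
  simp only [step (n := q + 1), step (n := q), Fin.prod_univ_succ, Fin.cons_zero, Fin.cons_succ]
  refine Finset.sum_congr rfl fun a _ => ?_
  rw [Finset.mul_sum]
  refine Finset.sum_congr rfl fun b _ => ?_
  rw [Finset.mul_sum, Finset.mul_sum]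
  refine Finset.sum_congr rfl fun d _ => ?_
  have hk (k : Fin q → T) :
      h a ((Fin.cons a (Fin.cons b (Fin.cons d k)) : Fin (q + 3) → T) 1)
        ((Fin.cons a (Fin.cons b (Fin.cons d k)) : Fin (q + 3) → T) 2) = h a b d := rfl
  simp only [hk, ← Finset.mul_sum, hrest, mul_one]
  simp only [← Fin.succ_zero_eq_one, ← Fin.succ_one_eq_two]
  ring

/-- Stationarity of a form depending on the first three arguments only. -/
theorem hasStationaryValue_three {q : ℕ} {T : Type} [Fintype T] {h : T → T → T → ℝ} {τ : T → ℝ}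
    {α : ℝ} (hτ : ∑ t, τ t = 1) (h0 : ∀ a, ∑ b, τ b * ∑ d, τ d * h a b d = α)
    (h1 : ∀ b, ∑ a, τ a * ∑ d, τ d * h a b d = α)
    (h2 : ∀ d, ∑ a, τ a * ∑ b, τ b * h a b d = α) :
    HasStationaryValue (fun k : Fin (q + 3) → T => h (k 0) (k 1) (k 2)) (fun _ => τ) α := by
  classical
  refine hasStationaryValue_of_single fun j t => ?_
  rw [multiForm_three h]
  · have h01 : (0 : Fin (q + 3)) ≠ 1 := by simp
    have h02 : (0 : Fin (q + 3)) ≠ 2 := Fin.ne_of_val_ne (by simp [Nat.mod_eq_of_lt])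
    have h12 : (1 : Fin (q + 3)) ≠ 2 := Fin.ne_of_val_ne (by simp [Nat.mod_eq_of_lt])
    by_cases hj0 : 0 = j
    · subst hj0
      simp [h01.symm, h02.symm, Pi.single_apply, h0]
    by_cases hj1 : 1 = j
    · subst hj1
      simp [h01, h12.symm, Pi.single_apply, h1]
    by_cases hj2 : 2 = j
    · subst hj2
      simp [h02, h12, Pi.single_apply, h2]
    simp [hj0, hj1, hj2, h0, ← Finset.sum_mul, hτ]
  · intro i
    rcases eq_or_ne i.succ.succ.succ j with h | h
    · simp [← h]
    · simp [h, hτ]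

/-- A rational probability distribution is the image of the uniform distribution on `ZMod N`, if
`N` is a multiple of the denominators. -/
theorem exists_map_zmod_card_fiber {Y : Type} [Fintype Y] [DecidableEq Y] (N : ℕ) [NeZero N]
    (r : Y → ℚ) (hr0 : ∀ y, 0 ≤ r y) (hr1 : ∑ y, r y = 1) (hN : ∀ y, (r y).den ∣ N) :
    ∃ g : ZMod N → Y, ∀ y, ∑ s, (N : ℝ)⁻¹ * (if g s = y then 1 else 0) = (r y : ℝ) := by
  have hN0 : (N : ℚ) ≠ 0 := NeZero.ne _
  have (y : Y) : ∃ n : ℕ, (n : ℚ) = N * r y := by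
    obtain ⟨m, hm⟩ := hN y
    refine ⟨m * (r y).num.toNat, ?_⟩
    have h1 : (((r y).num.toNat : ℤ) : ℚ) = (r y).num := by
      rw [Int.toNat_of_nonneg (Rat.num_nonneg.2 (hr0 y))]
    have h2 := Rat.mul_den_eq_num (r y)
    rw [hm]
    push_cast at h1 ⊢
    rw [h1, ← h2]
    ring
  choose n hn using this
  have hsum : ∑ y, n y = N := by
    rw [← Nat.cast_inj (R := ℚ), Nat.cast_sum]
    simp only [hn, ← Finset.mul_sum, hr1, mul_one]
  -- `ZMod N` is cut into blocks of sizes `n y = N * r y`.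
  let e : ZMod N ≃ Σ y, Fin (n y) := Fintype.equivOfCardEq (by simp [hsum, ZMod.card])
  refine ⟨fun s => (e s).1, fun y => ?_⟩
  rw [e.sum_comp fun x => (N : ℝ)⁻¹ * if x.1 = y then (1 : ℝ) else 0, Fintype.sum_sigma]
  have h := congrArg (Rat.cast : ℚ → ℝ) (hn y)
  push_cast at h
  have hN0' : (N : ℝ) ≠ 0 := NeZero.ne _
  rw [Finset.sum_eq_single y (fun z _ hz => by simp [hz]) (by simp)]
  simp [h]
  field_simp

/-- Positive algebraic masses are simulated robustly by at least three people. -/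
theorem exists_hasStationaryValue_of_pos {Y : Type} [Fintype Y] (c : Y → ℝ)
    (hc : ∀ y, IsAlgebraic ℚ (c y)) (hpos : ∀ y, 0 < c y) (hsum : ∑ y, c y = 1) (q : ℕ) :
    ∃ (T : Type) (_ : Fintype T) (τ : T → ℝ) (f : (Fin (q + 3) → T) → Y),
      τ ∈ stdSimplex ℝ T ∧ ∀ y, HasStationaryValue (eventCoeff f y) (fun _ => τ) (c y) := by
  classical
  obtain ⟨W, U, V, _, _, _, μ, ν, ρ, G, hμ, hν, hρ, hG0, hG1, h0, h1, h2⟩ :=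
    exists_rational_distributions c hc hpos hsum
  let N : ℕ := ∏ a, ∏ b, ∏ d, ∏ y, (G a b d y).den
  have : NeZero N := ⟨by simp [N, Finset.prod_eq_zero_iff]⟩
  have hN (a b d y) : (G a b d y).den ∣ N :=
    (Finset.dvd_prod_of_mem (fun y => (G a b d y).den) (Finset.mem_univ y)).trans <|
    (Finset.dvd_prod_of_mem (fun d => ∏ y, (G a b d y).den) (Finset.mem_univ d)).trans <|
    (Finset.dvd_prod_of_mem (fun b => ∏ d, ∏ y, (G a b d y).den) (Finset.mem_univ b)).trans <|
    Finset.dvd_prod_of_mem (fun a => ∏ b, ∏ d, ∏ y, (G a b d y).den) (Finset.mem_univ a)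
  have hN0 : (N : ℝ) ≠ 0 := NeZero.ne _
  choose g hg using fun a b d =>
    exists_map_zmod_card_fiber N (G a b d) (hG0 a b d) (hG1 a b d) (hN a b d)
  -- Translation permutes `ZMod N`, so one uniform summand suffices for the sum to be uniform.
  have hgl (a b d s y) :
      ∑ s', (N : ℝ)⁻¹ * (if g a b d (s + s') = y then 1 else 0) = (G a b d y : ℝ) := by
    rw [← hg a b d y]
    exact Equiv.sum_comp (Equiv.addLeft s) fun s => (N : ℝ)⁻¹ * (if g a b d s = y then (1 : ℝ) else 0)
  have hgr (a b d s y) :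
      ∑ s', (N : ℝ)⁻¹ * (if g a b d (s' + s) = y then 1 else 0) = (G a b d y : ℝ) := by
    simp only [add_comm _ s, hgl]
  -- Everyone samples from the same space, though each person's choice is read only in the relevant
  -- coordinates: `W`, `U`, `V` for the first three, and `ZMod N` for the first two.
  let T := (W × U × V) × ZMod N
  let τ : T → ℝ := fun t => μ t.1.1 * (ν t.1.2.1 * (ρ t.1.2.2 * (N : ℝ)⁻¹))
  have hinv : ∑ _s : ZMod N, (N : ℝ)⁻¹ = 1 := by
    simp [ZMod.card, hN0]
  have hτ (φ : W → U → V → ZMod N → ℝ) :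
      ∑ t, τ t * φ t.1.1 t.1.2.1 t.1.2.2 t.2 =
        ∑ a, μ a * ∑ b, ν b * ∑ d, ρ d * ∑ s, (N : ℝ)⁻¹ * φ a b d s := by
    simp only [T, τ, Fintype.sum_prod_type, Finset.mul_sum, mul_assoc]
  have hτ1 : ∑ t, τ t = 1 := by
    have h := hτ fun _ _ _ _ => 1
    simpa only [mul_one, hinv, hμ.2, hν.2, hρ.2] using h
  let H (y : Y) (a b d : T) : ℝ := if g a.1.1 b.1.2.1 d.1.2.2 (a.2 + b.2) = y then 1 else 0
  let f (k : Fin (q + 3) → T) : Y := g (k 0).1.1 (k 1).1.2.1 (k 2).1.2.2 ((k 0).2 + (k 1).2)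
  have hf (y) : eventCoeff f y = fun k => H y (k 0) (k 1) (k 2) := by
    funext k
    rw [eventCoeff_apply]
  have hV (y a b) : ∑ d, τ d * H y a b d =
      ∑ d, ρ d * (if g a.1.1 b.1.2.1 d (a.2 + b.2) = y then 1 else 0) := by
    refine (hτ fun _ _ d _ => if g a.1.1 b.1.2.1 d (a.2 + b.2) = y then 1 else 0).trans ?_
    simp only [← Finset.sum_mul, hinv, one_mul, hμ.2, hν.2]
  have hU (y a d) : ∑ b, τ b * H y a b d = ∑ b, ν b * (G a.1.1 b d.1.2.2 y : ℝ) := by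
    refine (hτ fun _ b _ s => if g a.1.1 b d.1.2.2 (a.2 + s) = y then 1 else 0).trans ?_
    simp only [hgl, ← Finset.sum_mul, one_mul, hμ.2, hρ.2]
  have hW (y b d) : ∑ a, τ a * H y a b d = ∑ a, μ a * (G a b.1.2.1 d.1.2.2 y : ℝ) := by
    refine (hτ fun a _ _ s => if g a b.1.2.1 d.1.2.2 (s + b.2) = y then 1 else 0).trans ?_
    simp only [hgr, ← Finset.sum_mul, one_mul, hν.2, hρ.2]
  have swap (φ : T → T → ℝ) : ∑ a, τ a * ∑ b, τ b * φ a b = ∑ b, τ b * ∑ a, τ a * φ a b := by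
    simp only [Finset.mul_sum]
    rw [Finset.sum_comm]
    exact Finset.sum_congr rfl fun _ _ => Finset.sum_congr rfl fun _ _ => mul_left_comm ..
  -- With the first sample fixed, only the second person's `ZMod N` coordinate randomizes the sum,
  -- so the average over `b` is taken first, whence the swap.
  have hUV (y a) : ∑ b, τ b * ∑ d, τ d * H y a b d = c y := by
    rw [swap]
    simp only [hU]
    refine (hτ fun _ _ d _ => ∑ b, ν b * (G a.1.1 b d y : ℝ)).trans ?_
    simp only [← Finset.sum_mul, hinv, one_mul, hμ.2, hν.2]
    rw [← h0 a.1.1 y]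
    simp only [Finset.mul_sum, mul_left_comm (ρ _)]
    exact Finset.sum_comm
  have hWV (y b) : ∑ a, τ a * ∑ d, τ d * H y a b d = c y := by
    rw [swap]
    simp only [hW]
    refine (hτ fun _ _ d _ => ∑ a, μ a * (G a b.1.2.1 d y : ℝ)).trans ?_
    simp only [← Finset.sum_mul, hinv, one_mul, hμ.2, hν.2]
    rw [← h1 b.1.2.1 y]
    simp only [Finset.mul_sum, mul_left_comm (ρ _)]
    exact Finset.sum_comm
  have hWU (y d) : ∑ a, τ a * ∑ b, τ b * H y a b d = c y := by
    simp only [hU]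
    refine (hτ fun a _ _ _ => ∑ b, ν b * (G a b d.1.2.2 y : ℝ)).trans ?_
    simp only [← Finset.sum_mul, hinv, one_mul, hν.2, hρ.2]
    exact h2 d.1.2.2 y
  refine ⟨T, inferInstance, τ, f, ⟨fun t => ?_, hτ1⟩, fun y => ?_⟩
  · exact mul_nonneg (hμ.1 _) (mul_nonneg (hν.1 _) (mul_nonneg (hρ.1 _) (by positivity)))
  · rw [hf]
    exact hasStationaryValue_three hτ1 (hUV y) (hWV y) (hWU y)

/-! ### Mystery-values, probability spaces and the main theorem. -/

theorem multiForm_one {ι : Type} [Fintype ι] [DecidableEq ι] {X : ι → Type}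
    [∀ i, Fintype (X i)] (w : ∀ i, X i → ℝ) : multiForm (fun _ => 1) w = ∏ i, ∑ t, w i t := by
  simp only [multiForm, one_mul, Fintype.prod_sum]

theorem multiForm_mem_Icc {ι : Type} [Fintype ι] [DecidableEq ι] {X : ι → Type}
    [∀ i, Fintype (X i)] {A : (∀ i, X i) → ℝ} {w : ∀ i, X i → ℝ}
    (hA : ∀ k, A k ∈ Set.Icc (0 : ℝ) 1) (hw : ∀ i, w i ∈ stdSimplex ℝ (X i)) :
    multiForm A w ∈ Set.Icc (0 : ℝ) 1 := by
  have hprod (k : ∀ i, X i) : 0 ≤ ∏ i, w i (k i) := Finset.prod_nonneg fun i _ => (hw i).1 _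
  have h1 : multiForm (fun _ => 1) w = 1 := by
    rw [multiForm_one]
    exact Finset.prod_eq_one fun i _ => (hw i).2
  refine ⟨Finset.sum_nonneg fun k _ => mul_nonneg (hA k).1 (hprod k), ?_⟩
  rw [← h1]
  exact Finset.sum_le_sum fun k _ => mul_le_mul_of_nonneg_right (hA k).2 (hprod k)

theorem HasStationaryValue.comp_equiv {ι : Type} [Fintype ι] [DecidableEq ι] {X X' : ι → Type}
    [∀ i, Fintype (X i)] [∀ i, Fintype (X' i)] {A : (∀ i, X i) → ℝ} {w : ∀ i, X i → ℝ} {α : ℝ}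
    (h : HasStationaryValue A w α) (e : ∀ i, X' i ≃ X i) :
    HasStationaryValue (fun k => A fun i => e i (k i)) (fun i t => w i (e i t)) α := by
  intro j x
  have hw : Function.update (fun i t => w i (e i t)) j x =
      fun i t => Function.update w j (x ∘ (e j).symm) i (e i t) := by
    funext i t
    rcases eq_or_ne i j with rfl | hij <;> simp [*]
  have hsum := (e j).symm.sum_comp x
  rw [hw, ← hsum]
  refine Eq.trans ?_ (h j (x ∘ (e j).symm))
  exact (Equiv.piCongrRight e).sum_comp fun k =>
    A k * ∏ i, Function.update w j (x ∘ (e j).symm) i (k i)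

/-- For vectors with coordinate sum one, mystery-values are stationary values. -/
theorem Hypermatrix.hasMysteryValue_iff {p : ℕ} {n : Fin p → ℕ} (A : Hypermatrix n) (α : ℝ)
    {β : ∀ i, Fin (n i) → ℝ} (hβ : ∀ i, ∑ k, β i k = 1) :
    A.HasMysteryValue α β ↔ HasStationaryValue A β α := by
  have hform (w : ∀ i, Fin (n i) → ℝ) :
      Hypermatrix.form (α • Hypermatrix.allOnes n - A) w =
        α * multiForm (fun _ => 1) w - multiForm A w := by
    simp only [Hypermatrix.form, multiForm, Finset.mul_sum, ← Finset.sum_sub_distrib]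
    refine Finset.sum_congr rfl fun k _ => ?_
    simp [Hypermatrix.allOnes, sub_mul]
  have hone (j) (x : Fin (n j) → ℝ) :
      multiForm (fun _ => 1) (Function.update β j x) = ∑ t, x t := by
    rw [multiForm_one, ← Finset.mul_prod_erase _ _ (Finset.mem_univ j), Function.update_self,
      Finset.prod_eq_one, mul_one]
    intro i hi
    rw [Function.update_of_ne (Finset.ne_of_mem_erase hi), hβ]
  refine ⟨fun h j x => ?_, fun h => ⟨fun j x => ?_, fun i => ?_⟩⟩
  · have := h.1 j x
    rw [hform, hone] at this
    linarith
  · rw [hform, hone, h j x, sub_self]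
  · simp [hβ]

theorem isAlgebraic_of_canRobustlySimulateSpace {p : ℕ} [NeZero p] {C : FiniteRandomSource}
    {Y : FinProbSpace} (h : CanRobustlySimulateSpace p C Y) (y : Y.carrier) :
    IsAlgebraic ℚ (Y.μ.real {y}) := by
  obtain ⟨X, -, f, hf⟩ := h
  exact ((isRobust_and_map_eq_iff X Y f).1 hf y).isAlgebraic (eventCoeff_eq_zero_or_one f y)
    fun i => sum_real_singleton_eq_one _

theorem canRobustlySimulateSpace_of_isAlgebraic (q : ℕ) (Y : FinProbSpace)
    (hY : ∀ y, IsAlgebraic ℚ (Y.μ.real {y})) :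
    CanRobustlySimulateSpace (q + 3) FiniteRandomSource.full Y := by
  classical
  -- The construction needs positive masses; points of mass zero are simply never hit.
  let Y' := {y // Y.μ.real {y} ≠ 0}
  have hsum : ∑ y : Y', Y.μ.real {y.1} = 1 := by
    rw [← sum_real_singleton_eq_one Y.μ,
      ← Finset.sum_filter_ne_zero (s := Finset.univ) (f := fun y => Y.μ.real {y})]
    exact (Finset.sum_subtype _ (by simp) fun y => Y.μ.real {y}).symm
  obtain ⟨T, _, τ, f, hτ, hf⟩ := exists_hasStationaryValue_of_pos (fun y : Y' => Y.μ.real {y.1})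
    (fun y => hY y) (fun y => lt_of_le_of_ne measureReal_nonneg y.2.symm) hsum q
  let P := FinProbSpace.ofWeights τ hτ
  refine ⟨fun _ => P, fun _ => Set.mem_univ _, fun k => (f k).1,
    (isRobust_and_map_eq_iff _ Y _).2 fun y => ?_⟩
  have hw : (fun (_ : Fin (q + 3)) (t : T) => P.μ.real {t}) = fun _ => τ := by
    funext _ t
    exact FinProbSpace.ofWeights_real_singleton τ hτ t
  change HasStationaryValue (X := fun _ => T) (eventCoeff (fun k : Fin (q + 3) → T => (f k).1) y)
    (fun _ t => P.μ.real {t}) _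
  rw [hw]
  by_cases hy : Y.μ.real {y} = 0
  · have h0 : eventCoeff (fun k : Fin (q + 3) → T => (f k).1) y = 0 := by
      funext k
      have : (f k).1 ≠ y := fun h => (f k).2 (h ▸ hy)
      simp [eventCoeff_apply, this]
    rw [h0, hy]
    intro j x
    simp [multiForm]
  · have h1 : eventCoeff (fun k : Fin (q + 3) → T => (f k).1) y = eventCoeff f ⟨y, hy⟩ := by
      funext k
      rw [eventCoeff_apply, eventCoeff_apply]
      exact if_congr (Subtype.ext_iff (a2 := ⟨y, hy⟩)).symm rfl rfl
    rw [h1]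
    exact hf ⟨y, hy⟩

theorem coin_real_singleton (α : ℝ) (hα : α ∈ Set.Icc (0 : ℝ) 1) (b : (coin α hα).carrier) :
    (coin α hα).μ.real {b} = cond b α (1 - α) := by
  have h (b : Bool) : ((ENNReal.ofReal α • Measure.dirac true +
      ENNReal.ofReal (1 - α) • Measure.dirac false : Measure Bool) {b}).toReal =
      cond b α (1 - α) := by
    cases b <;> simp [hα.1, hα.2]
  exact h b

theorem mainTheorem2 (p : ℕ) (hp : 3 ≤ p) :
    cooperativeNumbers p = {α : ℝ | IsAlgebraic ℚ α} ∩ Set.Icc 0 1 ∧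
    cooperativeNumbers p =
      {α : ℝ | ∃ (n : Fin p → ℕ) (A : Hypermatrix n) (β : ∀ i, Fin (n i) → ℝ),
        (∀ k, A k = 0 ∨ A k = 1) ∧ (∀ i, β i ∈ stdSimplex ℝ (Fin (n i))) ∧
        A.HasMysteryValue α β} ∧
    ∀ D : FiniteRandomSource,
      CanRobustlySimulate p FiniteRandomSource.full D ↔
        D.TakesProbabilitiesIn {α : ℝ | IsAlgebraic ℚ α} := by
  obtain ⟨q, rfl⟩ := Nat.exists_eq_add_of_le' hp
  have hcoop : cooperativeNumbers (q + 3) = {α : ℝ | IsAlgebraic ℚ α} ∩ Set.Icc 0 1 := by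
    ext α
    constructor
    · rintro ⟨hα, h⟩
      refine ⟨?_, hα⟩
      obtain ⟨t, ht⟩ : ∃ t, (coin α hα).μ.real {t} = α := ⟨true, coin_real_singleton α hα true⟩
      exact ht ▸ isAlgebraic_of_canRobustlySimulateSpace h t
    · rintro ⟨halg, hα⟩
      refine ⟨hα, canRobustlySimulateSpace_of_isAlgebraic q _ fun b => ?_⟩
      rw [coin_real_singleton]
      rcases b with _ | _
      · exact isAlgebraic_one.sub halg
      · exact halg
  refine ⟨hcoop, Set.Subset.antisymm ?_ ?_, fun D => ⟨fun h Y hY s _ => ?_, fun h Y hY => ?_⟩⟩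
  · rintro α ⟨hα, X, -, f, hf⟩
    obtain ⟨t, ht⟩ : ∃ t, (coin α hα).μ.real {t} = α := ⟨true, coin_real_singleton α hα true⟩
    have h := (isRobust_and_map_eq_iff X _ f).1 hf t
    rw [ht] at h
    let e (i : Fin (q + 3)) := (Fintype.equivFin (X i).carrier).symm
    have hβ (i) : (fun t => (X i).μ.real {e i t}) ∈ stdSimplex ℝ (Fin _) :=
      ⟨fun t => measureReal_nonneg, by
        rw [(e i).sum_comp fun t => (X i).μ.real {t}, sum_real_singleton_eq_one]⟩
    exact ⟨_, _, _, fun k => eventCoeff_eq_zero_or_one _ _ _, hβ,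
      (Hypermatrix.hasMysteryValue_iff _ α fun i => (hβ i).2).2 (h.comp_equiv e)⟩
  · rintro α ⟨n, A, β, hA, hβ, h⟩
    rw [Hypermatrix.hasMysteryValue_iff A α fun i => (hβ i).2] at h
    -- It remains to see that `α` is algebraic and lies in `[0, 1]`, the latter because it is the
    -- value of a `{0,1}`-form at stochastic vectors.
    rw [hcoop]
    refine ⟨h.isAlgebraic hA fun i => (hβ i).2, ?_⟩
    rw [← h.multiForm_eq fun i => (hβ i).2]
    exact multiForm_mem_Icc (fun k => by rcases hA k with h | h <;> simp [h]) hβ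
  · classical
    have hs : s = ((Finset.univ.filter (· ∈ s) : Finset Y.carrier) : Set Y.carrier) := by
      ext; simp
    rw [hs, ← sum_measureReal_singleton]
    exact (IsIntegral.sum _ fun y _ =>
      (isAlgebraic_of_canRobustlySimulateSpace (h Y hY) y).isIntegral).isAlgebraic
  · exact canRobustlySimulateSpace_of_isAlgebraic q Y fun y =>
      h Y hY {y} (measurableSet_singleton y)
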